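/- Let $\mathbb H$ be the real quaternion algebra and let $r(M)$ denote the rank of a quaternion matrix $M$ (the dimension of its column space as a right $\mathbb H$-vector space). Let $k\ge 1$ and let $A_i,B_i,C_i,D_i,E_i$ $(i=1,\dots,k)$ be quaternion matrices of compatible sizes. The system of $k$ equations in the $k+1$ unknown quaternion matrices $X_1,\dots,X_{k+1}$ $$A_iX_iB_i+C_iX_{i+1}D_i=E_i,\qquad i=1,\dots,k,$$ has a solution if and only if the following $2k(k+1)$ rank equalities hold for all $i=1,\dots,k$ and all $1\le m<n\le k$ (blank entries are zero): $$r\begin{pmatrix}A_i&E_i&C_i\end{pmatrix}=r\begin{pmatrix}A_i&C_i\end{pmatrix},\qquad r\begin{pmatrix}B_i\\E_i\\D_i\end{pmatrix}=r\begin{pmatrix}B_i\\D_i\end{pmatrix},$$ $$r\begin{pmatrix}A_i&E_i\\0&D_i\end{pmatrix}=r(A_i)+r(D_i),\qquad r\begin{pmatrix}B_i&0\\E_i&C_i\end{pmatrix}=r(B_i)+r(C_i),$$ $$r\begin{pmatrix}A_m&E_m&C_m\\&D_m&&B_{m+1}\\&&A_{m+1}&-E_{m+1}&C_{m+1}\\&&&\ddots&\ddots&\ddots\\&&&&A_n&(-1)^{n-m}E_n&C_n\end{pmatrix}=r\begin{pmatrix}A_m&C_m\\&A_{m+1}&C_{m+1}\\&&\ddots&\ddots\\&&&A_n&C_n\end{pmatrix}+r\begin{pmatrix}D_m&B_{m+1}\\&D_{m+1}&B_{m+2}\\&&\ddots&\ddots\\&&&D_{n-1}&B_n\end{pmatrix},$$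 $$r\begin{pmatrix}B_m\\E_m&C_m\\D_m&&B_{m+1}\\&A_{m+1}&-E_{m+1}&\ddots\\&&D_{m+1}&\ddots&B_n\\&&&\ddots&(-1)^{n-m}E_n\\&&&&D_n\end{pmatrix}=r\begin{pmatrix}C_m\\A_{m+1}&C_{m+1}\\&A_{m+2}&\ddots\\&&\ddots&C_{n-1}\\&&&A_n\end{pmatrix}+r\begin{pmatrix}B_m\\D_m&B_{m+1}\\&D_{m+1}&\ddots\\&&\ddots&B_n\\&&&D_n\end{pmatrix},$$ $$r\begin{pmatrix}A_m&E_m&C_m\\&D_m&&B_{m+1}\\&&A_{m+1}&-E_{m+1}&\ddots\\&&&D_{m+1}&\ddots&B_n\\&&&&\ddots&(-1)^{n-m}E_n\\&&&&&D_n\end{pmatrix}=r\begin{pmatrix}A_m&C_m\\&A_{m+1}&C_{m+1}\\&&\ddots&\ddots\\&&&A_{n-1}&C_{n-1}\\&&&&A_n\end{pmatrix}+r\begin{pmatrix}D_m&B_{m+1}\\&D_{m+1}&B_{m+2}\\&&\ddots&\ddots\\&&&D_{n-1}&B_n\\&&&&D_n\end{pmatrix},$$ $$r\begin{pmatrix}B_m\\E_m&C_m\\D_m&&B_{m+1}\\&A_{m+1}&-E_{m+1}&C_{m+1}\\&&\ddots&\ddots&\ddots\\&&&A_n&(-1)^{n-m}E_n&C_n\end{pmatrix}=r\begin{pmatrix}C_m\\A_{m+1}&C_{m+1}\\&A_{m+2}&C_{m+2}\\&&\ddots&\ddots\\&&&A_n&C_n\end{pmatrix}+r\begin{pmatrix}B_m\\D_m&B_{m+1}\\&D_{m+1}&B_{m+2}\\&&\ddots&\ddots\\&&&D_{n-1}&B_n\end{pmatrix}.$$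 -/

import Mathlib

open scoped Quaternion

namespace Sylvester

/-- The rank of a quaternion matrix: the dimension of its column space as a right vector space
over the quaternions, i.e. the maximal number of right linearly independent columns.  (Right
scalar multiplication is the action of the opposite ring; the left span of the columns would not
give the rank over a noncommutative division ring.) -/
noncomputable def rank {r c : Type*} (M : Matrix r c ℍ[ℝ]) : ℕ :=
  Module.finrank (ℍ[ℝ])ᵐᵒᵖ (Submodule.span (ℍ[ℝ])ᵐᵒᵖ (Set.range M.col))

/-! Sizes.  The equations are indexed by `i : Fin k` and the unknowns by `j : Fin (k + 1)`;
equation `i` involves the unknowns `i.castSucc` and `i.succ`.  The unknown `X j` is `a j × b j`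
and `E i` is `p i × q i`.  Sizes may be zero. -/

/-- The family `X` solves the system `A i * X i * B i + C i * X (i + 1) * D i = E i`. -/
def IsSolution {k : ℕ} {p q : Fin k → ℕ} {a b : Fin (k + 1) → ℕ}
    (A : ∀ i : Fin k, Matrix (Fin (p i)) (Fin (a i.castSucc)) ℍ[ℝ])
    (B : ∀ i : Fin k, Matrix (Fin (b i.castSucc)) (Fin (q i)) ℍ[ℝ])
    (C : ∀ i : Fin k, Matrix (Fin (p i)) (Fin (a i.succ)) ℍ[ℝ])
    (D : ∀ i : Fin k, Matrix (Fin (b i.succ)) (Fin (q i)) ℍ[ℝ])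
    (E : ∀ i : Fin k, Matrix (Fin (p i)) (Fin (q i)) ℍ[ℝ])
    (X : ∀ j : Fin (k + 1), Matrix (Fin (a j)) (Fin (b j)) ℍ[ℝ]) : Prop :=
  ∀ i : Fin k, A i * X i.castSucc * B i + C i * X i.succ * D i = E i

/-- The block bidiagonal matrix with one block row for each equation `i ∈ [m, n]` and one block
column for each `j ∈ S`: block row `i` has `A i` in block column `i.castSucc`, `C i` in block
column `i.succ`, and zeros elsewhere. -/
noncomputable def chainAC {k : ℕ} {p : Fin k → ℕ} {a : Fin (k + 1) → ℕ}
    (A : ∀ i : Fin k, Matrix (Fin (p i)) (Fin (a i.castSucc)) ℍ[ℝ])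
    (C : ∀ i : Fin k, Matrix (Fin (p i)) (Fin (a i.succ)) ℍ[ℝ])
    (m n : Fin k) (S : Set (Fin (k + 1))) :
    Matrix (Σ i : Set.Icc m n, Fin (p i)) (Σ j : S, Fin (a j)) ℍ[ℝ] :=
  Matrix.of fun x y =>
    if h : (y.1 : Fin (k + 1)) = (x.1 : Fin k).castSucc then
      A x.1 x.2 (Fin.cast (congrArg a h) y.2)
    else if h : (y.1 : Fin (k + 1)) = (x.1 : Fin k).succ then
      C x.1 x.2 (Fin.cast (congrArg a h) y.2)
    else 0

/-- The block bidiagonal matrix with one block column for each equation `i ∈ [m, n]` and one block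
row for each `j ∈ T`: block column `i` has `B i` in block row `i.castSucc`, `D i` in block row
`i.succ`, and zeros elsewhere. -/
noncomputable def chainBD {k : ℕ} {q : Fin k → ℕ} {b : Fin (k + 1) → ℕ}
    (B : ∀ i : Fin k, Matrix (Fin (b i.castSucc)) (Fin (q i)) ℍ[ℝ])
    (D : ∀ i : Fin k, Matrix (Fin (b i.succ)) (Fin (q i)) ℍ[ℝ])
    (m n : Fin k) (T : Set (Fin (k + 1))) :
    Matrix (Σ j : T, Fin (b j)) (Σ i : Set.Icc m n, Fin (q i)) ℍ[ℝ] :=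
  Matrix.of fun y x =>
    if h : (y.1 : Fin (k + 1)) = (x.1 : Fin k).castSucc then
      B x.1 (Fin.cast (congrArg b h) y.2) x.2
    else if h : (y.1 : Fin (k + 1)) = (x.1 : Fin k).succ then
      D x.1 (Fin.cast (congrArg b h) y.2) x.2
    else 0

/-- The large staircase matrix: its block rows are the rows of `chainAC` (equations `i ∈ [m, n]`)
and of `chainBD` (indices `j ∈ T`), its block columns are the columns of `chainBD` (equations
`i ∈ [m, n]`) and of `chainAC` (indices `j ∈ S`).  Equation `i` contributes the block
`(-1) ^ (i - m) • E i`.  The row and column index types carry no order, so listing the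
block rows and block columns alternately, as in the usual staircase picture

`A m  E m        C m`
`     D m               B (m+1)`
`              A (m+1)  -E (m+1)  C (m+1)`
`                       …`

describes the same matrix. -/
noncomputable def staircase {k : ℕ} {p q : Fin k → ℕ} {a b : Fin (k + 1) → ℕ}
    (A : ∀ i : Fin k, Matrix (Fin (p i)) (Fin (a i.castSucc)) ℍ[ℝ])
    (B : ∀ i : Fin k, Matrix (Fin (b i.castSucc)) (Fin (q i)) ℍ[ℝ])
    (C : ∀ i : Fin k, Matrix (Fin (p i)) (Fin (a i.succ)) ℍ[ℝ])
    (D : ∀ i : Fin k, Matrix (Fin (b i.succ)) (Fin (q i)) ℍ[ℝ])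
    (E : ∀ i : Fin k, Matrix (Fin (p i)) (Fin (q i)) ℍ[ℝ])
    (m n : Fin k) (S T : Set (Fin (k + 1))) :
    Matrix ((Σ i : Set.Icc m n, Fin (p i)) ⊕ (Σ j : T, Fin (b j)))
      ((Σ i : Set.Icc m n, Fin (q i)) ⊕ (Σ j : S, Fin (a j))) ℍ[ℝ] :=
  Matrix.fromBlocks
    (Matrix.blockDiagonal' fun i : Set.Icc m n =>
      (-1 : ℍ[ℝ]) ^ ((i : Fin k).val - m.val) • E i)
    (chainAC A C m n S)
    (chainBD B D m n T)
    0

/-- The rank equality for the equations `m, …, n` in which the block bidiagonal matrix of the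
`A`'s and `C`'s has the block columns `S`, and that of the `B`'s and `D`'s the block rows `T`. -/
def RankEq {k : ℕ} {p q : Fin k → ℕ} {a b : Fin (k + 1) → ℕ}
    (A : ∀ i : Fin k, Matrix (Fin (p i)) (Fin (a i.castSucc)) ℍ[ℝ])
    (B : ∀ i : Fin k, Matrix (Fin (b i.castSucc)) (Fin (q i)) ℍ[ℝ])
    (C : ∀ i : Fin k, Matrix (Fin (p i)) (Fin (a i.succ)) ℍ[ℝ])
    (D : ∀ i : Fin k, Matrix (Fin (b i.succ)) (Fin (q i)) ℍ[ℝ])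
    (E : ∀ i : Fin k, Matrix (Fin (p i)) (Fin (q i)) ℍ[ℝ])
    (m n : Fin k) (S T : Set (Fin (k + 1))) : Prop :=
  rank (staircase A B C D E m n S T) = rank (chainAC A C m n S) + rank (chainBD B D m n T)

end Sylvester

/-! A block matrix with blocks `E`, `M`, `N`, `0` has rank `rank M + rank N` exactly when `E` maps
the kernel of `N` into the range of `M`. So each rank equality is a statement about vectors
(`ChainCond`): if the vectors `v i` cancel at the shared indices, the signed values of `E i (v i)`
come from vectors `u j`. The four variants for given `m ≤ n` are the choices, at either end, between
imposing a constraint and leaving it free.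

A solution gives such `u` by `u j = ± X j (B j (v j))`, with the last entry read off from `D`. For
the converse, solve one equation at a time. A solution of the equations before `n` may be changed by
a homogeneous solution, and a map `Z` in position `n` extends backwards to one as soon as it
respects a finite list of pairs of subspaces (`flags`, `exists_homogeneous`). What remains is `A ∘ Z
∘ B + C ∘ X ∘ D = R` with `Z` respecting these pairs.

The crucial point is that the pairs are totally ordered. Over a division ring a map can then be
lifted compatibly with all of them at once, so the constrained equation is solvable if two
conditions hold for each single pair (`exists_solution_of_chain`). Each pair comes from chains
starting at some `m`, free or constrained there (`exists_chain_of_mem_flags`), and its two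
conditions are the chain conditions for `m, n` with the right end constrained and free. -/

namespace Sylvester

/-! ### Lifting linear maps compatibly with a flag of pairs of subspaces -/

section Flags

variable {K : Type*} [DivisionRing K]
variable {V W P U V' U' : Type*}
  [AddCommGroup V] [Module K V] [AddCommGroup W] [Module K W] [AddCommGroup P] [Module K P]
  [AddCommGroup U] [Module K U] [AddCommGroup V'] [Module K V'] [AddCommGroup U'] [Module K U']

/-- If `f` maps `S` into the image of `T` under `g`, then on `S` it lifts along `g` to a map with
values in `T`. -/
theorem exists_lift_of_le (f : V →ₗ[K] P) (g : U →ₗ[K] P) (S : Submodule K V) (T : Submodule K U)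
    (h : S ≤ (T.map g).comap f) :
    ∃ s : V →ₗ[K] U, ∀ v ∈ S, s v ∈ T ∧ g (s v) = f v := by
  let g' : T →ₗ[K] T.map g := (g.domRestrict T).codRestrict _ fun x => ⟨x, x.2, rfl⟩
  let f' : S →ₗ[K] T.map g := (f.domRestrict S).codRestrict _ fun x => h x.2
  have hg' : Function.Surjective g' := by
    rintro ⟨_, x, hx, rfl⟩
    exact ⟨⟨x, hx⟩, rfl⟩
  obtain ⟨t, ht⟩ := Module.projective_lifting_property g' f' hg'
  obtain ⟨s, hs⟩ := LinearMap.exists_extend (T.subtype ∘ₗ t)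
  refine ⟨s, fun v hv => ?_⟩
  have h1 : s v = t ⟨v, hv⟩ := LinearMap.congr_fun hs ⟨v, hv⟩
  rw [h1]
  exact ⟨(t ⟨v, hv⟩).2, congrArg Subtype.val (LinearMap.congr_fun ht ⟨v, hv⟩)⟩

/-- A map respecting a decreasing list of pairs of subspaces up to `g` lifts along `g` to a map
respecting that list. -/
theorem exists_lift_of_chain (f : V →ₗ[K] P) (g : U →ₗ[K] P)
    (l : List (Submodule K V × Submodule K U)) (hl : l.Pairwise (· ≥ ·))
    (h : ∀ x ∈ l, x.1 ≤ (x.2.map g).comap f) :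
    ∃ s : V →ₗ[K] U, ∀ x ∈ l, ∀ v ∈ x.1, s v ∈ x.2 ∧ g (s v) = f v := by
  induction l with
  | nil => exact ⟨0, by simp⟩
  | cons y l ih =>
    rw [List.pairwise_cons] at hl
    obtain ⟨s, hs⟩ := ih hl.2 fun x hx => h x (List.mem_cons_of_mem _ hx)
    obtain ⟨t, ht⟩ := exists_lift_of_le f g y.1 y.2 (h y List.mem_cons_self)
    cases l with
    | nil => exact ⟨t, by simpa using ht⟩
    | cons z l =>
      obtain ⟨π, hπ⟩ := LinearMap.exists_extend (LinearMap.id : z.1 →ₗ[K] z.1)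
      have hπ' (v : V) (hv : v ∈ z.1) : (π v : V) = v :=
        congrArg Subtype.val (LinearMap.congr_fun hπ ⟨v, hv⟩)
      have hzy : z ≤ y := hl.1 z List.mem_cons_self
      -- Use `s` on `z.1` and `t` on the complement cut out by `π`. Smaller members lie in `z.1`,
      -- where only `s` acts; for `y` itself, `z ≤ y` places both contributions in `y.2`.
      refine ⟨s ∘ₗ z.1.subtype ∘ₗ π + t ∘ₗ (LinearMap.id - z.1.subtype ∘ₗ π), ?_⟩
      intro x hx v hv
      simp only [LinearMap.add_apply, LinearMap.comp_apply, LinearMap.sub_apply,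
        LinearMap.id_apply, Submodule.subtype_apply]
      rcases List.mem_cons.1 hx with rfl | hx
      · obtain ⟨h1, h2⟩ := hs z List.mem_cons_self (π v) (π v).2
        obtain ⟨h3, h4⟩ := ht (v - π v) (sub_mem hv (hzy.1 (π v).2))
        exact ⟨add_mem (hzy.2 h1) h3, by rw [map_add, h2, h4, map_sub]; abel⟩
      · have hxz : x ≤ z := by
          rcases List.mem_cons.1 hx with rfl | hx'
          · exact le_rfl
          · exact (List.pairwise_cons.1 hl.2).1 x hx'
        rw [hπ' v (hxz.1 hv), sub_self, map_zero, add_zero]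
        exact hs x hx v hv

/-- A subspace has a projection that preserves every member of a given flag. -/
theorem exists_projection_of_chain (S : Submodule K V) (l : List (Submodule K V))
    (hl : l.Pairwise (· ≥ ·)) :
    ∃ π : V →ₗ[K] V, (∀ v, π v ∈ S) ∧ (∀ v ∈ S, π v = v) ∧ ∀ F ∈ l, ∀ v ∈ F, π v ∈ F := by
  -- A section of `V → V ⧸ S` that respects the flag; the pair `(⊤, ⊤)` makes it a section
  -- everywhere. The projection is the identity minus this section after `S.mkQ`.
  obtain ⟨s, hs⟩ := exists_lift_of_chain (LinearMap.id : (V ⧸ S) →ₗ[K] V ⧸ S) S.mkQ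
    ((⊤, ⊤) :: l.map fun F => (F.map S.mkQ, F)) (by
      refine List.pairwise_cons.2 ⟨fun _ _ => ⟨le_top, le_top⟩, ?_⟩
      rw [List.pairwise_map]
      exact hl.imp fun h => ⟨Submodule.map_mono h, h⟩) (by
      intro x hx
      rcases List.mem_cons.1 hx with rfl | hx
      · simp [Submodule.map_top]
      · obtain ⟨F, -, rfl⟩ := List.mem_map.1 hx
        exact le_rfl)
  refine ⟨LinearMap.id - s ∘ₗ S.mkQ, fun v => ?_, fun v hv => ?_, fun F hF v hv => ?_⟩
  · rw [← Submodule.Quotient.mk_eq_zero, ← Submodule.mkQ_apply]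
    have := (hs _ List.mem_cons_self (S.mkQ v) trivial).2
    simp only [LinearMap.sub_apply, LinearMap.id_apply, LinearMap.comp_apply, map_sub] at this ⊢
    rw [this, sub_self]
  · have : S.mkQ v = 0 := by rwa [← LinearMap.mem_ker, S.ker_mkQ]
    simp only [LinearMap.sub_apply, LinearMap.id_apply, LinearMap.comp_apply, this, map_zero,
      sub_zero]
  · exact sub_mem hv (hs _ (List.mem_cons_of_mem _ (List.mem_map_of_mem hF)) (S.mkQ v)
      ⟨v, hv, rfl⟩).1

/-- A map factors through `B` respecting a flag as soon as this is the case on the range of `B`. -/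
theorem exists_factor_of_chain (B : V →ₗ[K] W) (f : V →ₗ[K] U)
    (l : List (Submodule K W × Submodule K U)) (hl : l.Pairwise (· ≥ ·)) (hbot : (⊥, ⊥) ∈ l)
    (h : ∀ x ∈ l, ∀ v, B v ∈ x.1 → f v ∈ x.2) :
    ∃ Z : W →ₗ[K] U, Z ∘ₗ B = f ∧ ∀ x ∈ l, ∀ w ∈ x.1, Z w ∈ x.2 := by
  obtain ⟨π, hπ1, hπ2, hπ3⟩ := exists_projection_of_chain (LinearMap.range B) (l.map Prod.fst) (by
    rw [List.pairwise_map]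
    exact hl.imp fun h => h.1)
  obtain ⟨t, ht⟩ := exists_lift_of_le LinearMap.id B (LinearMap.range B) ⊤
    (by simp [Submodule.map_top])
  refine ⟨f ∘ₗ t ∘ₗ π, LinearMap.ext fun v => ?_, fun x hx w hw => h x hx _ ?_⟩
  · simp only [LinearMap.comp_apply]
    rw [hπ2 _ ⟨v, rfl⟩, ← sub_eq_zero, ← map_sub]
    -- The pair `(⊥, ⊥)` says that `f` vanishes on the kernel of `B`, so the choice of preimage `t`
    -- is harmless.
    exact h _ hbot _ (by simp [(ht (B v) ⟨v, rfl⟩).2])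
  · have := (ht (π w) (hπ1 w)).2
    simp only [LinearMap.comp_apply]
    rw [this]
    exact hπ3 x.1 (List.mem_map_of_mem hx) w hw

/-- Solvability of `A ∘ Z ∘ B + C ∘ X ∘ D = E` with `Z` required to respect a flag. -/
theorem exists_solution_of_chain (A : U →ₗ[K] P) (B : V →ₗ[K] W) (C : U' →ₗ[K] P)
    (D : V →ₗ[K] V') (E : V →ₗ[K] P)
    (l : List (Submodule K W × Submodule K U)) (hl : l.Pairwise (· ≥ ·))
    (hbot : (⊥, ⊥) ∈ l) (htop : (⊤, ⊤) ∈ l)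
    (h1 : ∀ x ∈ l, ∀ v, B v ∈ x.1 → D v = 0 → ∃ g ∈ x.2, E v = A g)
    (h2 : ∀ x ∈ l, ∀ v, B v ∈ x.1 → ∃ g ∈ x.2, ∃ u, E v = A g + C u) :
    ∃ (Z : W →ₗ[K] U) (X : V' →ₗ[K] U'),
      (∀ x ∈ l, ∀ w ∈ x.1, Z w ∈ x.2) ∧ A ∘ₗ Z ∘ₗ B + C ∘ₗ X ∘ₗ D = E := by
  obtain ⟨π, hπ1, hπ2, hπ3⟩ := exists_projection_of_chain (LinearMap.ker D)
    (l.map fun x => x.1.comap B) (by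
      rw [List.pairwise_map]
      exact hl.imp fun h => Submodule.comap_mono h.1)
  -- On `ker D` the unknown `X` drops out, so `Z ∘ B` must be a lift of `E` along `A`.
  obtain ⟨Z₁, hZ₁⟩ := exists_lift_of_chain E A
    (l.map fun x => (x.1.comap B ⊓ LinearMap.ker D, x.2)) (by
      rw [List.pairwise_map]
      exact hl.imp fun h => ⟨inf_le_inf_right _ (Submodule.comap_mono h.1), h.2⟩) (by
      intro y hy
      obtain ⟨x, hx, rfl⟩ := List.mem_map.1 hy
      rintro v ⟨hv1, hv2⟩
      obtain ⟨g, hg, hE⟩ := h1 x hx v hv1 hv2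
      exact ⟨g, hg, hE.symm⟩)
  have key (x) (hx : x ∈ l) (v : V) (hv : B v ∈ x.1) :
      Z₁ (π v) ∈ x.2 ∧ A (Z₁ (π v)) = E (π v) :=
    hZ₁ _ (List.mem_map_of_mem hx) (π v) ⟨hπ3 _ (List.mem_map_of_mem hx) v hv, hπ1 v⟩
  let f := (LinearMap.ker D).liftQ (E - A ∘ₗ Z₁ ∘ₗ π) (fun v hv => by
    have h0 := (key _ htop v trivial).2
    rw [hπ2 v hv] at h0
    simp [hπ2 v hv, h0])
  -- Modulo `ker D` both unknowns are found together as one lift along `A.coprod C`; the second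
  -- component is unconstrained, hence the `⊤`.
  obtain ⟨s, hs⟩ := exists_lift_of_chain f (A.coprod C)
    (l.map fun x => ((x.1.comap B).map (LinearMap.ker D).mkQ, x.2.prod ⊤)) (by
      rw [List.pairwise_map]
      exact hl.imp fun h => ⟨Submodule.map_mono (Submodule.comap_mono h.1),
        Submodule.prod_mono h.2 le_rfl⟩) (by
      intro y hy
      obtain ⟨x, hx, rfl⟩ := List.mem_map.1 hy
      rintro _ ⟨v, hv, rfl⟩
      obtain ⟨g, hg, u, hE⟩ := h2 x hx v hv
      refine ⟨(g - Z₁ (π v), u), ⟨sub_mem hg (key x hx v hv).1, trivial⟩, ?_⟩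
      simp only [LinearMap.coprod_apply, f, Submodule.mkQ_apply, Submodule.liftQ_apply,
        LinearMap.sub_apply, LinearMap.comp_apply, map_sub, hE]
      abel)
  have hs' (x) (hx : x ∈ l) (v : V) (hv : B v ∈ x.1) := hs _ (List.mem_map_of_mem hx)
    ((LinearMap.ker D).mkQ v) ⟨v, hv, rfl⟩
  obtain ⟨Z, hZ, hZl⟩ := exists_factor_of_chain B
    (Z₁ ∘ₗ π + LinearMap.fst K U U' ∘ₗ s ∘ₗ (LinearMap.ker D).mkQ) l hl hbot
    (fun x hx v hv => add_mem (key x hx v hv).1 (hs' x hx v hv).1.1)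
  obtain ⟨X, hX, -⟩ := exists_factor_of_chain D
    (LinearMap.snd K U U' ∘ₗ s ∘ₗ (LinearMap.ker D).mkQ) [(⊥, ⊥)] (by simp) (by simp) (by
      simp only [List.mem_singleton, forall_eq, Submodule.mem_bot]
      intro v hv
      have : (LinearMap.ker D).mkQ v = 0 := by
        rwa [← LinearMap.mem_ker, Submodule.ker_mkQ, LinearMap.mem_ker]
      simp only [LinearMap.comp_apply, this, map_zero])
  refine ⟨Z, X, hZl, ?_⟩
  rw [hZ, hX]
  ext v
  have h0 := (hs' _ htop v trivial).2
  simp only [LinearMap.coprod_apply, f, Submodule.mkQ_apply, Submodule.liftQ_apply,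
    LinearMap.sub_apply, LinearMap.comp_apply] at h0
  simp only [LinearMap.add_apply, LinearMap.comp_apply, map_add, Submodule.mkQ_apply,
    LinearMap.fst_apply, LinearMap.snd_apply]
  rw [add_assoc, h0]
  abel

end Flags

/-! ### The system of linear maps: flags, chains and the induction on equations -/

section System

variable {K : Type*} [DivisionRing K] {k : ℕ}
variable {a b : Fin (k + 1) → Type*} {p q : Fin k → Type*}
  [∀ j, AddCommGroup (a j)] [∀ j, Module K (a j)] [∀ j, AddCommGroup (b j)] [∀ j, Module K (b j)]
  [∀ i, AddCommGroup (p i)] [∀ i, Module K (p i)] [∀ i, AddCommGroup (q i)] [∀ i, Module K (q i)]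
variable (A : ∀ i : Fin k, a i.castSucc →ₗ[K] p i) (B : ∀ i : Fin k, q i →ₗ[K] b i.castSucc)
  (C : ∀ i : Fin k, a i.succ →ₗ[K] p i) (D : ∀ i : Fin k, q i →ₗ[K] b i.succ)
  (E : ∀ i : Fin k, q i →ₗ[K] p i)

/-- The pairs of subspaces of `b j` and `a j` that a map `b j → a j` has to respect in order to
extend to a solution of the homogeneous equations with index less than `j`. -/
def flags : ∀ j : Fin (k + 1), List (Submodule K (b j) × Submodule K (a j)) :=
  Fin.induction [(⊤, ⊤), (⊥, ⊥)] fun i l =>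
    (⊤, ⊤) :: (l.map (fun x =>
      ((x.1.comap (B i)).map (D i), (x.2.map (A i)).comap (C i))) ++ [(⊥, ⊥)])

theorem flags_zero : flags A B C D 0 = [(⊤, ⊤), (⊥, ⊥)] := rfl

theorem flags_succ (i : Fin k) :
    flags A B C D i.succ = (⊤, ⊤) :: ((flags A B C D i.castSucc).map (fun x =>
      ((x.1.comap (B i)).map (D i), (x.2.map (A i)).comap (C i))) ++ [(⊥, ⊥)]) :=
  Fin.induction_succ _ _ _

theorem top_mem_flags (j : Fin (k + 1)) : (⊤, ⊤) ∈ flags A B C D j := by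
  cases j using Fin.cases with
  | zero => simp [flags_zero]
  | succ i => simp [flags_succ]

theorem bot_mem_flags (j : Fin (k + 1)) : (⊥, ⊥) ∈ flags A B C D j := by
  cases j using Fin.cases with
  | zero => simp [flags_zero]
  | succ i => simp [flags_succ]

theorem pairwise_flags (j : Fin (k + 1)) : (flags A B C D j).Pairwise (· ≥ ·) := by
  induction j using Fin.induction with
  | zero =>
    rw [flags_zero, List.pairwise_pair]
    exact ⟨bot_le, bot_le⟩
  | succ i ih =>
    rw [flags_succ, List.pairwise_cons, List.pairwise_append, List.pairwise_map]
    refine ⟨fun _ _ => ⟨le_top, le_top⟩, ih.imp fun h => ?_, List.pairwise_singleton _ _, ?_⟩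
    · exact ⟨Submodule.map_mono (Submodule.comap_mono h.1),
        Submodule.comap_mono (Submodule.map_mono h.2)⟩
    · intro x _ y hy
      rw [List.mem_singleton.1 hy]
      exact ⟨bot_le, bot_le⟩

/-- Descent from `j` to `0`: the pairs at `i.succ` are those at `i.castSucc` transported through
equation `i`, which is just what is needed to choose the preceding unknown within its own flag. -/
theorem exists_homogeneous (j : Fin (k + 1)) (Z : b j →ₗ[K] a j)
    (hZ : ∀ x ∈ flags A B C D j, ∀ w ∈ x.1, Z w ∈ x.2) :
    ∃ X : ∀ j, b j →ₗ[K] a j, X j = Z ∧ ∀ i : Fin k, i.castSucc < j →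
      A i ∘ₗ X i.castSucc ∘ₗ B i + C i ∘ₗ X i.succ ∘ₗ D i = 0 := by
  induction j using Fin.induction with
  | zero => exact ⟨Function.update 0 0 Z, by simp, fun i hi => absurd hi (Fin.not_lt_zero _)⟩
  | succ i ih =>
    have hlift (x) (hx : x ∈ flags A B C D i.castSucc) (v) (hv : B i v ∈ x.1) :
        ∃ g ∈ x.2, (-(C i ∘ₗ Z ∘ₗ D i)) v = A i g := by
      obtain ⟨g, hg, h⟩ := hZ ((x.1.comap (B i)).map (D i), (x.2.map (A i)).comap (C i))
        (by simp only [flags_succ, List.mem_cons, List.mem_append, List.mem_map]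
            exact .inr (.inl ⟨x, hx, rfl⟩)) (D i v) ⟨v, hv, rfl⟩
      exact ⟨-g, neg_mem hg, by simp [h]⟩
    -- With `Z` fixed only `A ∘ Z' ∘ B` is unknown, so the second term is switched off by zero maps.
    obtain ⟨Z', Y, hZ', hE⟩ := exists_solution_of_chain (A i) (B i) (0 : a i.succ →ₗ[K] p i)
      (0 : q i →ₗ[K] b i.succ) (-(C i ∘ₗ Z ∘ₗ D i)) _ (pairwise_flags A B C D i.castSucc)
      (bot_mem_flags ..) (top_mem_flags ..) (fun x hx v hv _ => hlift x hx v hv)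
      (fun x hx v hv => by
        obtain ⟨g, hg, h⟩ := hlift x hx v hv
        exact ⟨g, hg, 0, by simpa using h⟩)
    obtain ⟨X, hX, hXi⟩ := ih Z' hZ'
    refine ⟨Function.update X i.succ Z, Function.update_self .., fun i' hi' => ?_⟩
    rcases (Fin.castSucc_lt_succ_iff.1 hi').lt_or_eq with h | rfl
    · rw [Function.update_of_ne hi'.ne, Function.update_of_ne (by simpa using h.ne)]
      exact hXi i' (Fin.castSucc_lt_castSucc_iff.2 h)
    · rw [Function.update_of_ne hi'.ne, Function.update_self, hX]
      simp only [add_zero, LinearMap.comp_zero] at hE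
      rw [hE, neg_add_cancel]

/-- The vector of all `B i (v i)`. -/
def leftEnd (v : ∀ i, q i) : ∀ j, b j :=
  Fin.lastCases 0 fun i => B i (v i)

/-- The vector of all `D i (v i)`. -/
def rightEnd (v : ∀ i, q i) : ∀ j, b j :=
  Fin.cases 0 fun i => D i (v i)

@[simp] theorem leftEnd_castSucc (v : ∀ i, q i) (i : Fin k) :
    leftEnd B v i.castSucc = B i (v i) := Fin.lastCases_castSucc ..

@[simp] theorem leftEnd_last (v : ∀ i, q i) : leftEnd B v (Fin.last k) = 0 :=
  Fin.lastCases_last ..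

@[simp] theorem rightEnd_succ (v : ∀ i, q i) (i : Fin k) : rightEnd D v i.succ = D i (v i) := rfl

@[simp] theorem rightEnd_zero (v : ∀ i, q i) : rightEnd D v 0 = 0 := rfl

theorem leftEnd_eq_zero (v : ∀ i, q i) (j : Fin (k + 1))
    (h : ∀ i : Fin k, i.castSucc = j → v i = 0) : leftEnd B v j = 0 := by
  cases j using Fin.lastCases with
  | last => simp
  | cast i => simp [h i rfl]

theorem rightEnd_eq_zero (v : ∀ i, q i) (j : Fin (k + 1))
    (h : ∀ i : Fin k, i.succ = j → v i = 0) : rightEnd D v j = 0 := by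
  cases j using Fin.cases with
  | zero => simp
  | succ i => simp [h i rfl]

/-- The combination of the blocks `B i` and `D i` with coefficients `v`. -/
def ends : (∀ i, q i) →ₗ[K] ∀ j, b j where
  toFun v := leftEnd B v + rightEnd D v
  map_add' v w := by
    have h1 : leftEnd B (v + w) = leftEnd B v + leftEnd B w := by
      ext j; cases j using Fin.lastCases <;> simp
    have h2 : rightEnd D (v + w) = rightEnd D v + rightEnd D w := by
      ext j; cases j using Fin.cases <;> simp
    rw [h1, h2]; abel
  map_smul' c v := by
    have h1 : leftEnd B (c • v) = c • leftEnd B v := by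
      ext j; cases j using Fin.lastCases <;> simp
    have h2 : rightEnd D (c • v) = c • rightEnd D v := by
      ext j; cases j using Fin.cases <;> simp
    rw [h1, h2, RingHom.id_apply, smul_add]

theorem ends_apply (v : ∀ i, q i) (j : Fin (k + 1)) :
    ends B D v j = leftEnd B v j + rightEnd D v j := rfl

theorem ends_single (i : Fin k) (y : q i) :
    ends B D (Pi.single i y) = Pi.single i.castSucc (B i y) + Pi.single i.succ (D i y) := by
  have h1 : leftEnd B (Pi.single i y) = Pi.single i.castSucc (B i y) := by
    ext j
    cases j using Fin.lastCases with
    | last => simp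
    | cast i' =>
      rcases eq_or_ne i' i with rfl | h
      · simp
      · simp [Pi.single_eq_of_ne h, Pi.single_eq_of_ne (mt Fin.castSucc_inj.1 h)]
  have h2 : rightEnd D (Pi.single i y) = Pi.single i.succ (D i y) := by
    ext j
    cases j using Fin.cases with
    | zero => simp
    | succ i' =>
      rcases eq_or_ne i' i with rfl | h
      · simp
      · simp [Pi.single_eq_of_ne h, Pi.single_eq_of_ne (mt Fin.succ_inj.1 h)]
  ext j
  rw [ends_apply, h1, h2, Pi.add_apply]

/-- Every pair in `flags j` consists of the ends of the chains that start at some index `s`;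
`e` tells whether these chains are constrained at `s`. -/
theorem exists_chain_of_mem_flags (j : Fin (k + 1)) :
    ∀ x ∈ flags A B C D j, ∃ s ≤ j, ∃ e : Prop,
      (∀ w ∈ x.1, ∃ v : ∀ i, q i, (∀ i : Fin k, ¬ (s ≤ i.castSucc ∧ i.castSucc < j) → v i = 0) ∧
        ∀ l, (l = s → e) → ends B D v l + Pi.single j w l = 0) ∧
      ∀ u : ∀ j, a j, (e → u s = 0) → (∀ i : Fin k, s ≤ i.castSucc → i.castSucc < j →
        A i (u i.castSucc) + C i (u i.succ) = 0) → u j ∈ x.2 := by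
  have htop (j : Fin (k + 1)) : ∃ s ≤ j, ∃ e : Prop,
      (∀ w ∈ (⊤ : Submodule K (b j)), ∃ v : ∀ i, q i,
        (∀ i : Fin k, ¬ (s ≤ i.castSucc ∧ i.castSucc < j) → v i = 0) ∧
        ∀ l, (l = s → e) → ends B D v l + Pi.single j w l = 0) ∧
      ∀ u : ∀ j, a j, (e → u s = 0) → (∀ i : Fin k, s ≤ i.castSucc → i.castSucc < j →
        A i (u i.castSucc) + C i (u i.succ) = 0) → u j ∈ (⊤ : Submodule K (a j)) := by
    refine ⟨j, le_rfl, False, fun w _ => ⟨0, by simp, fun l hl => ?_⟩, fun u _ _ => trivial⟩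
    simp [Pi.single_eq_of_ne hl]
  have hbot (j : Fin (k + 1)) : ∃ s ≤ j, ∃ e : Prop,
      (∀ w ∈ (⊥ : Submodule K (b j)), ∃ v : ∀ i, q i,
        (∀ i : Fin k, ¬ (s ≤ i.castSucc ∧ i.castSucc < j) → v i = 0) ∧
        ∀ l, (l = s → e) → ends B D v l + Pi.single j w l = 0) ∧
      ∀ u : ∀ j, a j, (e → u s = 0) → (∀ i : Fin k, s ≤ i.castSucc → i.castSucc < j →
        A i (u i.castSucc) + C i (u i.succ) = 0) → u j ∈ (⊥ : Submodule K (a j)) := by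
    refine ⟨j, le_rfl, True, fun w hw => ⟨0, by simp, fun l hl => ?_⟩, fun u hu _ => hu trivial⟩
    rw [(Submodule.mem_bot K).1 hw]
    simp
  induction j using Fin.induction with
  | zero =>
    intro x hx
    simp only [flags_zero, List.mem_cons, List.not_mem_nil, or_false] at hx
    rcases hx with rfl | rfl
    · exact htop 0
    · exact hbot 0
  | succ i ih =>
    intro x hx
    simp only [flags_succ, List.mem_cons, List.mem_append, List.mem_map, List.not_mem_nil,
      or_false] at hx
    rcases hx with rfl | ⟨x, hx, rfl⟩ | rfl
    · exact htop i.succ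
    · obtain ⟨s, hs, e, hv, hu⟩ := ih x hx
      refine ⟨s, hs.trans (Fin.castSucc_lt_succ).le, e, ?_, fun u hus hui => ?_⟩
      · rintro _ ⟨y, hy, rfl⟩
        obtain ⟨v, hvi, hvl⟩ := hv _ hy
        -- Appending `y` cancels the old end `B i y` and creates the new end `D i y`; the global
        -- sign turns it into `-D i y`, which cancels `w`.
        refine ⟨-(v + Pi.single i y), fun i' hi' => ?_, fun l hl => ?_⟩
        · have h1 : i' ≠ i := by
            rintro rfl
            exact hi' ⟨hs, Fin.castSucc_lt_succ⟩
          have h2 : v i' = 0 := hvi i' fun h => hi' ⟨h.1, h.2.trans Fin.castSucc_lt_succ⟩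
          simp [h1, h2]
        · rw [map_neg, map_add, ends_single, Pi.neg_apply, Pi.add_apply, Pi.add_apply,
            ← add_assoc, hvl l hl, zero_add, neg_add_cancel]
      · have h1 := hu u hus fun i' h1 h2 => hui i' h1 (h2.trans Fin.castSucc_lt_succ)
        refine ⟨-u i.castSucc, neg_mem h1, ?_⟩
        rw [map_neg, neg_eq_iff_add_eq_zero]
        exact hui i hs Fin.castSucc_lt_succ
    · exact hbot i.succ

/-- The solvability condition attached to the equations `m, …, n`: chains `v` that are constrained
at the left end if `e` and at the right end if `e'` are mapped by `E` to values of chains that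
vanish at the left end if `e` and at the right end if `e'`. -/
def ChainCond (m n : Fin k) (e e' : Prop) : Prop :=
  ∀ v : ∀ i, q i, (∀ i, ¬ (m ≤ i ∧ i ≤ n) → v i = 0) →
    (∀ l, (l = m.castSucc → e) → (l = n.succ → e') → ends B D v l = 0) →
    ∃ u : ∀ j, a j, (e → u m.castSucc = 0) ∧ (e' → u n.succ = 0) ∧ ∀ i, m ≤ i → i ≤ n →
      (-1 : ℤ) ^ (i : ℕ) • E i (v i) = A i (u i.castSucc) + C i (u i.succ)

/-- Cancellation at `i.succ` replaces `B` of the next entry by `-D i (v i)`; the alternating sign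
absorbs this minus. -/
theorem apply_add_apply_of_ends_eq_zero (X : ∀ j, b j →ₗ[K] a j) (v : ∀ i, q i) (i : Fin k)
    (hX : A i ∘ₗ X i.castSucc ∘ₗ B i + C i ∘ₗ X i.succ ∘ₗ D i = E i)
    (hv : ends B D v i.succ = 0) :
    A i ((-1 : ℤ) ^ (i.castSucc : ℕ) • X i.castSucc (leftEnd B v i.castSucc)) +
      C i ((-1 : ℤ) ^ (i.succ : ℕ) • X i.succ (leftEnd B v i.succ)) =
      (-1 : ℤ) ^ (i : ℕ) • E i (v i) := by
  rw [ends_apply, rightEnd_succ] at hv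
  rw [eq_neg_of_add_eq_zero_left hv, ← hX]
  simp [pow_succ]

theorem leftEnd_eq_zero_of_support {m n : Fin k} (hmn : m ≤ n) {e e' : Prop} {v : ∀ i, q i}
    (hv : ∀ i, ¬ (m ≤ i ∧ i ≤ n) → v i = 0)
    (h : ∀ l, (l = m.castSucc → e) → (l = n.succ → e') → ends B D v l = 0) (he : e) :
    leftEnd B v m.castSucc = 0 := by
  have h1 := h m.castSucc (fun _ => he)
    (fun h => absurd h (Fin.castSucc_lt_succ_iff.2 hmn).ne)
  rwa [ends_apply, rightEnd_eq_zero, add_zero] at h1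
  intro i hi
  refine hv i fun hh => ?_
  have := Fin.castSucc_lt_succ_iff.2 hh.1
  exact this.ne' hi

theorem rightEnd_eq_zero_of_support {m n : Fin k} (hmn : m ≤ n) {e e' : Prop} {v : ∀ i, q i}
    (hv : ∀ i, ¬ (m ≤ i ∧ i ≤ n) → v i = 0)
    (h : ∀ l, (l = m.castSucc → e) → (l = n.succ → e') → ends B D v l = 0) (he : e') :
    D n (v n) = 0 := by
  have h1 := h n.succ (fun h => absurd h (Fin.castSucc_lt_succ_iff.2 hmn).ne') (fun _ => he)
  rwa [ends_apply, leftEnd_eq_zero, zero_add, rightEnd_succ] at h1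
  intro i hi
  refine hv i fun hh => ?_
  have := Fin.castSucc_lt_succ_iff.2 hh.2
  exact this.ne hi

theorem chainCond_of_solution (X : ∀ j, b j →ₗ[K] a j)
    (hX : ∀ i, A i ∘ₗ X i.castSucc ∘ₗ B i + C i ∘ₗ X i.succ ∘ₗ D i = E i)
    {m n : Fin k} (hmn : m ≤ n) (e e' : Prop) : ChainCond A B C D E m n e e' := by
  intro v hv h
  -- At `n.succ` no later entry of `v` carries the value and no cancellation need hold, so `D n (v
  -- n)` is used directly, with exponent `n`.
  refine ⟨Function.update (fun j => (-1 : ℤ) ^ (j : ℕ) • X j (leftEnd B v j)) n.succ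
    ((-1 : ℤ) ^ (n : ℕ) • X n.succ (D n (v n))), fun he => ?_, fun he => ?_, fun i hmi hin => ?_⟩
  · rw [Function.update_of_ne (Fin.castSucc_lt_succ_iff.2 hmn).ne,
      leftEnd_eq_zero_of_support B D hmn hv h he, map_zero, smul_zero]
  · rw [Function.update_self, rightEnd_eq_zero_of_support B D hmn hv h he, map_zero, smul_zero]
  · rw [Function.update_of_ne (Fin.castSucc_lt_succ_iff.2 hin).ne]
    rcases hin.lt_or_eq with hin | rfl
    · rw [Function.update_of_ne (by simpa using hin.ne)]
      refine (apply_add_apply_of_ends_eq_zero A B C D E X v i (hX i) (h _ ?_ ?_)).symm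
      · exact fun h => absurd h (Fin.castSucc_lt_succ_iff.2 hmi).ne'
      · exact fun h => absurd (Fin.succ_inj.1 h) hin.ne
    · rw [Function.update_self, ← hX i]
      simp

theorem exists_solution_of_chainCond
    (h : ∀ m n, m ≤ n → ∀ e e', ChainCond A B C D E m n e e') (j : Fin (k + 1)) :
    ∃ X : ∀ j, b j →ₗ[K] a j, ∀ i : Fin k, i.castSucc < j →
      A i ∘ₗ X i.castSucc ∘ₗ B i + C i ∘ₗ X i.succ ∘ₗ D i = E i := by
  induction j using Fin.induction with
  | zero => exact ⟨0, fun i hi => absurd hi (Fin.not_lt_zero _)⟩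
  | succ n ih =>
    obtain ⟨X, hX⟩ := ih
    -- Both hypotheses of `exists_solution_of_chain` for the residual of equation `n`: `e'` true is
    -- the one on `ker D`, `e'` false the unrestricted one.
    have key (x) (hx : x ∈ flags A B C D n.castSucc) (e' : Prop) (y : q n) (hy : B n y ∈ x.1)
        (hD : e' → D n y = 0) : ∃ g ∈ x.2, ∃ u, (e' → u = 0) ∧
          (E n - A n ∘ₗ X n.castSucc ∘ₗ B n) y = A n g + C n u := by
      obtain ⟨s, hs, e, hv, hu⟩ := exists_chain_of_mem_flags A B C D _ x hx
      obtain ⟨m, rfl⟩ : ∃ m : Fin k, m.castSucc = s :=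
        ⟨s.castPred (hs.trans_lt (Fin.castSucc_lt_last n)).ne, Fin.castSucc_castPred ..⟩
      have hmn : m ≤ n := hs
      obtain ⟨v, hvs, hvl⟩ := hv _ hy
      have hvn : v n = 0 := hvs n fun h => h.2.false
      have hsupp : ∀ i, ¬ (m ≤ i ∧ i ≤ n) → (v + Pi.single n y) i = 0 := by
        intro i hi
        have h1 : i ≠ n := by
          rintro rfl
          exact hi ⟨hmn, le_rfl⟩
        have h2 : v i = 0 := hvs i fun h => hi ⟨h.1, le_of_lt h.2⟩
        simp [h1, h2]
      have hends : ∀ l, (l = m.castSucc → e) → (l = n.succ → e') →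
          ends B D (v + Pi.single n y) l = 0 := by
        intro l hl hl'
        rw [map_add, ends_single, Pi.add_apply, Pi.add_apply, ← add_assoc, hvl l hl, zero_add]
        rcases eq_or_ne l n.succ with rfl | hne
        · simp [hD (hl' rfl)]
        · exact Pi.single_eq_of_ne hne _
      obtain ⟨u, hum, hun, hui⟩ := h m n hmn e e' _ hsupp hends
      -- Both families solve the same recursion before `n`, one by the chain condition and one by
      -- `X`; their difference is homogeneous, so its value at `n` lies in `x.2`.
      have hG := hu (fun j => u j - (-1 : ℤ) ^ (j : ℕ) • X j (leftEnd B (v + Pi.single n y) j))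
        (fun he => by
          rw [hum he, leftEnd_eq_zero_of_support B D hmn hsupp hends he, map_zero, smul_zero,
            sub_zero])
        (fun i hmi hin => by
          have h1 := apply_add_apply_of_ends_eq_zero A B C D E X _ i (hX i hin)
            (hends i.succ (fun h => absurd h (lt_of_le_of_lt hmi Fin.castSucc_lt_succ).ne')
              (fun h => absurd (Fin.succ_inj.1 h) (ne_of_lt hin)))
          rw [hui i hmi (le_of_lt hin)] at h1
          rw [map_sub, map_sub, sub_add_sub_comm, h1, sub_self])
      refine ⟨_, zsmul_mem hG ((-1) ^ (n : ℕ)), (-1 : ℤ) ^ (n : ℕ) • u n.succ,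
        fun he => by rw [hun he, smul_zero], ?_⟩
      have h2 := hui n hmn le_rfl
      have h3 : (-1 : ℤ) ^ (n : ℕ) * (-1 : ℤ) ^ (n : ℕ) = 1 := by
        rw [← mul_pow]; simp
      rw [Pi.add_apply, hvn, Pi.single_eq_same, zero_add] at h2
      rw [leftEnd_castSucc, Pi.add_apply, hvn, Pi.single_eq_same, zero_add, smul_sub, smul_smul,
        Fin.val_castSucc, h3, one_smul, map_sub, map_zsmul, map_zsmul, sub_add_eq_add_sub,
        ← smul_add, ← h2, smul_smul, h3, one_smul]
      rfl
    obtain ⟨Z, X', hZ, hE⟩ := exists_solution_of_chain (A n) (B n) (C n) (D n)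
      (E n - A n ∘ₗ X n.castSucc ∘ₗ B n) _ (pairwise_flags A B C D n.castSucc)
      (bot_mem_flags ..) (top_mem_flags ..)
      (fun x hx y hy hD => by
        obtain ⟨g, hg, u, hu, h⟩ := key x hx True y hy fun _ => hD
        exact ⟨g, hg, by rw [h, hu trivial, map_zero, add_zero]⟩)
      (fun x hx y hy => by
        obtain ⟨g, hg, u, -, h⟩ := key x hx False y hy False.elim
        exact ⟨g, hg, u, h⟩)
    obtain ⟨Y, hY, hYi⟩ := exists_homogeneous A B C D n.castSucc Z hZ
    refine ⟨Function.update (X + Y) n.succ X', fun i hi => ?_⟩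
    rw [Function.update_of_ne hi.ne]
    rcases (Fin.castSucc_lt_succ_iff.1 hi).lt_or_eq with hin | rfl
    · rw [Function.update_of_ne (by simpa using hin.ne)]
      have h1 := hX i (Fin.castSucc_lt_castSucc_iff.2 hin)
      have h2 := hYi i (Fin.castSucc_lt_castSucc_iff.2 hin)
      rw [← add_zero (E i), ← h1, ← h2]
      simp only [Pi.add_apply, LinearMap.add_comp, LinearMap.comp_add]
      abel
    · rw [Function.update_self, Pi.add_apply, hY]
      rw [eq_sub_iff_add_eq] at hE
      rw [← hE]
      simp only [LinearMap.add_comp, LinearMap.comp_add]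
      abel

/-- The system `A i ∘ X i ∘ B i + C i ∘ X (i + 1) ∘ D i = E i` of linear maps over a division ring
is solvable if and only if all the chain conditions hold. -/
theorem exists_solution_iff_chainCond :
    (∃ X : ∀ j, b j →ₗ[K] a j,
      ∀ i, A i ∘ₗ X i.castSucc ∘ₗ B i + C i ∘ₗ X i.succ ∘ₗ D i = E i) ↔
    ∀ m n, m ≤ n → ∀ e e', ChainCond A B C D E m n e e' := by
  constructor
  · rintro ⟨X, hX⟩ m n hmn e e'
    exact chainCond_of_solution A B C D E X hX hmn e e'
  · intro h
    obtain ⟨X, hX⟩ := exists_solution_of_chainCond A B C D E h (Fin.last k)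
    exact ⟨X, fun i => hX i (Fin.castSucc_lt_last i)⟩

end System

/-! ### Quaternion rank and block matrices -/

section Rank

theorem finrank_eq_of_eq {K V : Type*} [DivisionRing K] [AddCommGroup V] [Module K V]
    {S T : Submodule K V} (h : S = T) : Module.finrank K S = Module.finrank K T := by
  rw [h]

/-- The dimension of a subspace of a product, by projecting to the second factor. -/
theorem finrank_eq_finrank_map_snd_add {K V W : Type*} [DivisionRing K] [AddCommGroup V]
    [Module K V] [AddCommGroup W] [Module K W] [FiniteDimensional K V] [FiniteDimensional K W]
    (R : Submodule K (V × W)) :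
    Module.finrank K R = Module.finrank K (R.map (LinearMap.snd K V W)) +
      Module.finrank K (R.comap (LinearMap.inl K V W)) := by
  rw [← LinearMap.finrank_range_add_finrank_ker ((LinearMap.snd K V W).domRestrict R),
    LinearMap.range_domRestrict]
  congr 1
  let f : R.comap (LinearMap.inl K V W) →ₗ[K] R :=
    (LinearMap.inl K V W).restrict fun _ h => h
  have hf : Function.Injective f := fun x y h =>
    Subtype.ext (congrArg (fun t : R => (t : V × W).1) h)
  rw [← LinearMap.finrank_range_of_inj hf]
  refine finrank_eq_of_eq ?_
  ext ⟨⟨x, y⟩, h⟩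
  simp only [LinearMap.mem_ker, LinearMap.mem_range, LinearMap.domRestrict_apply,
    LinearMap.snd_apply]
  constructor
  · rintro rfl
    exact ⟨⟨x, h⟩, rfl⟩
  · rintro ⟨z, hz⟩
    exact (congrArg (fun t : R => (t : V × W).2) hz).symm

/-- Project the range to `W`: the image is the range of `N`, and the fibre over `0` contains the
range of `M`. Equal dimensions mean that this fibre is no larger. -/
theorem finrank_range_block_eq_iff {K Q U V W : Type*} [DivisionRing K] [AddCommGroup Q]
    [Module K Q] [AddCommGroup U] [Module K U] [AddCommGroup V] [Module K V] [AddCommGroup W]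
    [Module K W] [FiniteDimensional K V] [FiniteDimensional K W]
    (E : Q →ₗ[K] V) (M : U →ₗ[K] V) (N : Q →ₗ[K] W) :
    Module.finrank K (LinearMap.range ((E.coprod M).prod (N ∘ₗ LinearMap.fst K Q U))) =
        Module.finrank K (LinearMap.range M) + Module.finrank K (LinearMap.range N) ↔
      ∀ v, N v = 0 → ∃ u, E v = M u := by
  rw [finrank_eq_finrank_map_snd_add, add_comm, ← LinearMap.range_comp, LinearMap.snd_prod,
    LinearMap.range_comp_of_range_eq_top _ Submodule.range_fst, Nat.add_right_cancel_iff]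
  have hle : LinearMap.range M ≤ (LinearMap.range ((E.coprod M).prod
      (N ∘ₗ LinearMap.fst K Q U))).comap (LinearMap.inl K V W) := by
    rintro _ ⟨u, rfl⟩
    exact ⟨(0, u), by simp⟩
  constructor
  · intro h v hv
    have hmem : E v ∈ (LinearMap.range ((E.coprod M).prod
      (N ∘ₗ LinearMap.fst K Q U))).comap (LinearMap.inl K V W) := ⟨(v, 0), by simp [hv]⟩
    rw [← Submodule.eq_of_le_of_finrank_eq hle h.symm] at hmem
    obtain ⟨u, hu⟩ := hmem
    exact ⟨u, hu.symm⟩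
  · intro h
    refine finrank_eq_of_eq ?_
    refine le_antisymm ?_ hle
    rintro x ⟨⟨v, u⟩, hvu⟩
    obtain ⟨u', hu'⟩ := h v (congrArg Prod.snd hvu)
    exact ⟨u' + u, by rw [map_add, ← hu']; exact congrArg Prod.fst hvu⟩

instance finite_mulOpposite {R : Type*} [Ring R] : Module.Finite Rᵐᵒᵖ R :=
  Module.Finite.of_surjective (LinearMap.toSpanSingleton Rᵐᵒᵖ R 1)
    fun x => ⟨MulOpposite.op x, one_mul x⟩

variable {m n o l : Type*} [Fintype n] [Fintype l]

/-- A matrix over a possibly noncommutative ring, acting on columns, is linear for the right scalar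
multiplication. -/
def colLin {R : Type*} [Ring R] (M : Matrix m n R) : (n → R) →ₗ[Rᵐᵒᵖ] (m → R) where
  toFun := M.mulVec
  map_add' := M.mulVec_add
  map_smul' c v := M.mulVec_smul c v

@[simp] theorem colLin_apply {R : Type*} [Ring R] (M : Matrix m n R) (v : n → R) :
    colLin M v = M.mulVec v := rfl

theorem colLin_mul {R : Type*} [Ring R] (M : Matrix m n R) (N : Matrix n l R) :
    colLin (M * N) = colLin M ∘ₗ colLin N :=
  LinearMap.ext fun v => (M.mulVec_mulVec v N).symm

theorem colLin_add {R : Type*} [Ring R] (M N : Matrix m n R) :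
    colLin (M + N) = colLin M + colLin N :=
  LinearMap.ext fun v => M.add_mulVec N v

theorem colLin_injective {R : Type*} [Ring R] :
    Function.Injective (colLin : Matrix m n R → (n → R) →ₗ[Rᵐᵒᵖ] (m → R)) := by
  classical
  exact fun M N h => Matrix.ext_of_mulVec_single fun i => LinearMap.congr_fun h _

theorem colLin_surjective {R : Type*} [Ring R] :
    Function.Surjective (colLin : Matrix m n R → (n → R) →ₗ[Rᵐᵒᵖ] (m → R)) := by
  classical
  intro f
  refine ⟨Matrix.of fun i j => f (Pi.single j 1) i, LinearMap.pi_ext fun j x => ?_⟩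
  -- Right linearity allows the scalar to be pulled out on the right, so values at the standard
  -- vectors determine `f`.
  have hx : Pi.single j x = MulOpposite.op x • (Pi.single j 1 : n → R) := by
    rw [← Pi.single_smul, op_smul_eq_mul, one_mul]
  rw [hx, map_smul, map_smul, colLin_apply, Matrix.mulVec_single_one]
  rfl

theorem rank_eq_finrank_range (M : Matrix m n ℍ[ℝ]) :
    rank M = Module.finrank (ℍ[ℝ])ᵐᵒᵖ (LinearMap.range (colLin M)) := by
  classical
  unfold rank
  refine finrank_eq_of_eq ?_
  refine le_antisymm (Submodule.span_le.2 ?_) ?_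
  · rintro _ ⟨j, rfl⟩
    exact ⟨Pi.single j 1, M.mulVec_single_one j⟩
  · rintro _ ⟨v, rfl⟩
    rw [colLin_apply, Matrix.mulVec_eq_sum]
    exact sum_mem fun j _ => Submodule.smul_mem _ _ (Submodule.subset_span ⟨j, rfl⟩)

theorem finrank_range_comp_equiv {K V W V' W' : Type*} [DivisionRing K] [AddCommGroup V]
    [Module K V] [AddCommGroup W] [Module K W] [AddCommGroup V'] [Module K V'] [AddCommGroup W']
    [Module K W'] (f : V →ₗ[K] W) (e : V' ≃ₗ[K] V) (e' : W ≃ₗ[K] W') :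
    Module.finrank K (LinearMap.range (e'.toLinearMap ∘ₗ f ∘ₗ e.toLinearMap)) =
      Module.finrank K (LinearMap.range f) := by
  rw [LinearMap.range_comp, LinearMap.range_comp_of_range_eq_top _ e.range]
  exact e'.finrank_map_eq _

theorem rank_submatrix_equiv {m' n' : Type*} [Fintype n'] (M : Matrix m n ℍ[ℝ]) (e : m' ≃ m)
    (e' : n' ≃ n) : rank (M.submatrix e e') = rank M := by
  rw [rank_eq_finrank_range, rank_eq_finrank_range, ← finrank_range_comp_equiv (colLin M)
    (LinearEquiv.funCongrLeft (ℍ[ℝ])ᵐᵒᵖ ℍ[ℝ] e'.symm) (LinearEquiv.funCongrLeft (ℍ[ℝ])ᵐᵒᵖ ℍ[ℝ] e)]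
  refine finrank_eq_of_eq ?_
  exact congrArg LinearMap.range (LinearMap.ext fun v => M.submatrix_mulVec_equiv v e e')

theorem rank_fromBlocks_zero_eq_iff [Finite m] [Finite o] (E : Matrix m n ℍ[ℝ])
    (M : Matrix m l ℍ[ℝ]) (N : Matrix o n ℍ[ℝ]) :
    rank (Matrix.fromBlocks E M N 0) = rank M + rank N ↔
      ∀ v, N.mulVec v = 0 → ∃ u, E.mulVec v = M.mulVec u := by
  rw [rank_eq_finrank_range, rank_eq_finrank_range, rank_eq_finrank_range]
  refine Iff.trans ?_ (finrank_range_block_eq_iff (colLin E) (colLin M) (colLin N))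
  rw [← finrank_range_comp_equiv ((colLin E).coprod _ |>.prod _)
    (LinearEquiv.sumArrowLequivProdArrow n l (ℍ[ℝ])ᵐᵒᵖ ℍ[ℝ])
    (LinearEquiv.sumArrowLequivProdArrow m o (ℍ[ℝ])ᵐᵒᵖ ℍ[ℝ]).symm]
  refine Eq.congr_left ?_
  refine finrank_eq_of_eq ?_
  refine congrArg LinearMap.range (LinearMap.ext fun v => ?_)
  rw [colLin_apply, Matrix.fromBlocks_mulVec, Matrix.zero_mulVec, add_zero]
  ext (i | i) <;> rfl

theorem rank_of_isEmpty_rows [IsEmpty m] (M : Matrix m n ℍ[ℝ]) : rank M = 0 := by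
  rw [rank_eq_finrank_range]
  exact Module.finrank_zero_of_subsingleton

theorem rank_of_isEmpty_cols [IsEmpty n] (M : Matrix m n ℍ[ℝ]) : rank M = 0 := by
  rw [rank_eq_finrank_range, Subsingleton.elim (colLin M) 0, LinearMap.range_zero]
  exact finrank_bot _ _

variable {c : Type*}

/-- The block criterion with an empty `N`, after permuting the columns. -/
theorem rank_fromCols_eq_iff [Fintype c] [Finite m] (A : Matrix m l ℍ[ℝ]) (E : Matrix m n ℍ[ℝ])
    (C : Matrix m c ℍ[ℝ]) :
    rank (Matrix.fromCols (Matrix.fromCols A E) C) = rank (Matrix.fromCols A C) ↔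
      ∀ v, ∃ x y, E.mulVec v = A.mulVec x + C.mulVec y := by
  have h := rank_fromBlocks_zero_eq_iff E (Matrix.fromCols A C) (0 : Matrix Empty n ℍ[ℝ])
  rw [rank_of_isEmpty_rows (0 : Matrix Empty n ℍ[ℝ]), add_zero,
    ← rank_submatrix_equiv _ (Equiv.sumEmpty m Empty).symm
      (((Equiv.sumComm l n).sumCongr (Equiv.refl c)).trans (Equiv.sumAssoc n l c))] at h
  have hM : Matrix.fromCols (Matrix.fromCols A E) C =
      (Matrix.fromBlocks E (Matrix.fromCols A C) (0 : Matrix Empty n ℍ[ℝ]) 0).submatrix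
        (Equiv.sumEmpty m Empty).symm
        (((Equiv.sumComm l n).sumCongr (Equiv.refl c)).trans (Equiv.sumAssoc n l c)) := by
    ext i ((j | j) | j) <;> rfl
  rw [hM, h]
  refine forall_congr' fun v => ⟨fun h => ?_, fun ⟨x, y, h⟩ _ => ⟨Sum.elim x y, ?_⟩⟩
  · obtain ⟨u, hu⟩ := h (Subsingleton.elim _ _)
    exact ⟨u ∘ Sum.inl, u ∘ Sum.inr, by rw [hu, Matrix.fromCols_mulVec]⟩
  · rw [h, Matrix.fromCols_mulVec_sumElim]

theorem rank_fromRows_eq_iff [Finite m] [Finite o] [Finite c] (B : Matrix o n ℍ[ℝ])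
    (E : Matrix m n ℍ[ℝ]) (D : Matrix c n ℍ[ℝ]) :
    rank (Matrix.fromRows (Matrix.fromRows B E) D) = rank (Matrix.fromRows B D) ↔
      ∀ v, B.mulVec v = 0 → D.mulVec v = 0 → E.mulVec v = 0 := by
  have h := rank_fromBlocks_zero_eq_iff E (0 : Matrix m Empty ℍ[ℝ]) (Matrix.fromRows B D)
  rw [rank_of_isEmpty_cols (0 : Matrix m Empty ℍ[ℝ]), zero_add,
    ← rank_submatrix_equiv _
      (((Equiv.sumComm o m).sumCongr (Equiv.refl c)).trans (Equiv.sumAssoc m o c))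
      (Equiv.sumEmpty n Empty).symm] at h
  have hM : Matrix.fromRows (Matrix.fromRows B E) D =
      (Matrix.fromBlocks E (0 : Matrix m Empty ℍ[ℝ]) (Matrix.fromRows B D) 0).submatrix
        (((Equiv.sumComm o m).sumCongr (Equiv.refl c)).trans (Equiv.sumAssoc m o c))
        (Equiv.sumEmpty n Empty).symm := by
    ext ((i | i) | i) j <;> rfl
  rw [hM, h]
  refine forall_congr' fun v => ?_
  rw [Matrix.fromRows_mulVec]
  constructor
  · intro h hB hD
    obtain ⟨u, hu⟩ := h (by rw [hB, hD]; ext (i | i) <;> rfl)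
    rw [hu, Matrix.zero_mulVec]
  · intro h hv
    exact ⟨0, by
      rw [Matrix.zero_mulVec]
      exact h (funext fun i => congrFun hv (.inl i)) (funext fun i => congrFun hv (.inr i))⟩

theorem rank_fromBlocks_upper_eq_iff [Finite m] [Finite o] (A : Matrix m l ℍ[ℝ])
    (E : Matrix m n ℍ[ℝ]) (D : Matrix o n ℍ[ℝ]) :
    rank (Matrix.fromBlocks A E 0 D) = rank A + rank D ↔
      ∀ v, D.mulVec v = 0 → ∃ x, E.mulVec v = A.mulVec x := by
  rw [← rank_fromBlocks_zero_eq_iff, ← rank_submatrix_equiv (Matrix.fromBlocks A E 0 D)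
    (Equiv.refl _) (Equiv.sumComm n l)]
  exact Eq.congr_left (congrArg rank (by ext (i | i) (j | j) <;> rfl))

theorem rank_fromBlocks_lower_eq_iff [Finite m] [Finite o] (B : Matrix o n ℍ[ℝ])
    (E : Matrix m n ℍ[ℝ]) (C : Matrix m l ℍ[ℝ]) :
    rank (Matrix.fromBlocks B 0 E C) = rank B + rank C ↔
      ∀ v, B.mulVec v = 0 → ∃ y, E.mulVec v = C.mulVec y := by
  rw [← rank_fromBlocks_zero_eq_iff, add_comm,
    ← rank_submatrix_equiv (Matrix.fromBlocks B 0 E C) (Equiv.sumComm m o) (Equiv.refl _)]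
  exact Eq.congr_left (congrArg rank (by ext (i | i) (j | j) <;> rfl))

end Rank

/-! ### Chain conditions for one equation -/

section SingleEquation

variable {K : Type*} [DivisionRing K] {k : ℕ}
variable {a b : Fin (k + 1) → Type*} {p q : Fin k → Type*}
  [∀ j, AddCommGroup (a j)] [∀ j, Module K (a j)] [∀ j, AddCommGroup (b j)] [∀ j, Module K (b j)]
  [∀ i, AddCommGroup (p i)] [∀ i, Module K (p i)] [∀ i, AddCommGroup (q i)] [∀ i, Module K (q i)]
variable (A : ∀ i : Fin k, a i.castSucc →ₗ[K] p i) (B : ∀ i : Fin k, q i →ₗ[K] b i.castSucc)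
  (C : ∀ i : Fin k, a i.succ →ₗ[K] p i) (D : ∀ i : Fin k, q i →ₗ[K] b i.succ)
  (E : ∀ i : Fin k, q i →ₗ[K] p i)

theorem chainCond_self_iff (i : Fin k) (e e' : Prop) :
    ChainCond A B C D E i i e e' ↔ ∀ y, (e → B i y = 0) → (e' → D i y = 0) →
      ∃ x x', (e → x = 0) ∧ (e' → x' = 0) ∧ E i y = A i x + C i x' := by
  have hne : i.castSucc ≠ i.succ := Fin.castSucc_lt_succ.ne
  have hsign : (-1 : ℤ) ^ (i : ℕ) * (-1 : ℤ) ^ (i : ℕ) = 1 := by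
    rw [← mul_pow]; simp
  constructor
  · intro h y hB hD
    obtain ⟨u, hu, hu', hE⟩ := h (Pi.single i y)
      (fun i' hi' => Pi.single_eq_of_ne (fun h => hi' ⟨h.ge, h.le⟩) _) (by
        intro l hl hl'
        rw [ends_single, Pi.add_apply]
        rcases eq_or_ne l i.castSucc with rfl | h1
        · rw [Pi.single_eq_same, Pi.single_eq_of_ne hne, hB (hl rfl), add_zero]
        · rw [Pi.single_eq_of_ne h1, zero_add]
          rcases eq_or_ne l i.succ with rfl | h2
          · rw [Pi.single_eq_same, hD (hl' rfl)]
          · rw [Pi.single_eq_of_ne h2])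
    refine ⟨(-1 : ℤ) ^ (i : ℕ) • u i.castSucc, (-1 : ℤ) ^ (i : ℕ) • u i.succ,
      fun he => by rw [hu he, smul_zero], fun he => by rw [hu' he, smul_zero], ?_⟩
    have h1 := hE i le_rfl le_rfl
    rw [Pi.single_eq_same] at h1
    rw [map_zsmul, map_zsmul, ← smul_add, ← h1, smul_smul, hsign, one_smul]
  · intro h v hv hends
    have hB (he : e) : B i (v i) = 0 := by
      rw [← leftEnd_castSucc B]
      exact leftEnd_eq_zero_of_support B D le_rfl hv hends he
    have hD (he : e') : D i (v i) = 0 :=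
      rightEnd_eq_zero_of_support B D le_rfl hv hends he
    obtain ⟨x, x', hx, hx', hE⟩ := h (v i) hB hD
    refine ⟨Function.update (Function.update 0 i.castSucc ((-1 : ℤ) ^ (i : ℕ) • x)) i.succ
      ((-1 : ℤ) ^ (i : ℕ) • x'), fun he => ?_, fun he => ?_, fun i' h1 h2 => ?_⟩
    · rw [Function.update_of_ne hne, Function.update_self, hx he, smul_zero]
    · rw [Function.update_self, hx' he, smul_zero]
    · obtain rfl := le_antisymm h1 h2
      rw [Function.update_self, Function.update_of_ne hne, Function.update_self, hE, smul_add,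
        map_zsmul, map_zsmul]

end SingleEquation

/-! ### From staircase matrices to chain conditions -/

section Matrices

variable {k : ℕ} {p q : Fin k → ℕ} {a b : Fin (k + 1) → ℕ}
variable (A : ∀ i : Fin k, Matrix (Fin (p i)) (Fin (a i.castSucc)) ℍ[ℝ])
  (B : ∀ i : Fin k, Matrix (Fin (b i.castSucc)) (Fin (q i)) ℍ[ℝ])
  (C : ∀ i : Fin k, Matrix (Fin (p i)) (Fin (a i.succ)) ℍ[ℝ])
  (D : ∀ i : Fin k, Matrix (Fin (b i.succ)) (Fin (q i)) ℍ[ℝ])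
  (E : ∀ i : Fin k, Matrix (Fin (p i)) (Fin (q i)) ℍ[ℝ])

theorem sum_subtype_eq_sum {ι M : Type*} [Fintype ι] [AddCommMonoid M] (s : Set ι) [Fintype s]
    (f : ι → M) (hf : ∀ i ∉ s, f i = 0) : ∑ i : s, f i = ∑ i, f i :=
  Fintype.sum_of_injective Subtype.val Subtype.val_injective _ _
    (fun i hi => hf i (by simpa using hi)) fun _ => rfl

theorem chainAC_mulVec (m n : Fin k) (S : Set (Fin (k + 1))) [Fintype S]
    (u : ∀ j, Fin (a j) → ℍ[ℝ]) (hu : ∀ j ∉ S, u j = 0) (x : Σ i : Set.Icc m n, Fin (p i)) :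
    (chainAC A C m n S).mulVec (fun y => u y.1 y.2) x =
      ((A x.1).mulVec (u (x.1 : Fin k).castSucc) + (C x.1).mulVec (u (x.1 : Fin k).succ)) x.2 := by
  obtain ⟨⟨i, hi⟩, x⟩ := x
  have hne : i.succ ≠ i.castSucc := Fin.castSucc_lt_succ.ne'
  let f (j : Fin (k + 1)) : ℍ[ℝ] := ∑ y : Fin (a j),
    (if h : j = i.castSucc then A i x (Fin.cast (congrArg a h) y)
      else if h : j = i.succ then C i x (Fin.cast (congrArg a h) y) else 0) * u j y
  have h1 : (chainAC A C m n S).mulVec (fun y => u y.1 y.2) ⟨⟨i, hi⟩, x⟩ = ∑ j : S, f j :=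
    Fintype.sum_sigma _
  rw [h1, sum_subtype_eq_sum S f fun j hj => by simp [f, hu j hj],
    ← Fintype.sum_subset (s := {i.castSucc, i.succ}), Finset.sum_pair hne.symm]
  · simp [f, hne, Matrix.mulVec, dotProduct]
  · intro j hj
    by_contra h
    simp only [Finset.mem_insert, Finset.mem_singleton, not_or] at h
    exact hj (by simp [f, h.1, h.2])

theorem chainBD_mulVec (m n : Fin k) (T : Set (Fin (k + 1)))
    (v : ∀ i, Fin (q i) → ℍ[ℝ]) (hv : ∀ i, ¬ (m ≤ i ∧ i ≤ n) → v i = 0)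
    (y : Σ j : T, Fin (b j)) :
    (chainBD B D m n T).mulVec (fun x => v x.1 x.2) y =
      ends (b := fun j => Fin (b j) → ℍ[ℝ]) (fun i => colLin (B i)) (fun i => colLin (D i)) v y.1 y.2 := by
  obtain ⟨⟨j, hj⟩, y⟩ := y
  let f (i : Fin k) : ℍ[ℝ] := ∑ x : Fin (q i),
    (if h : j = i.castSucc then B i (Fin.cast (congrArg b h) y) x
      else if h : j = i.succ then D i (Fin.cast (congrArg b h) y) x else 0) * v i x
  -- Splitting `f` into its `B` and `D` parts leaves at most one nonzero term in each sum; none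
  -- survives at the last, respectively first, index.
  let g (i : Fin k) : ℍ[ℝ] :=
    if h : j = i.castSucc then (B i).mulVec (v i) (Fin.cast (congrArg b h) y) else 0
  let g' (i : Fin k) : ℍ[ℝ] :=
    if h : j = i.succ then (D i).mulVec (v i) (Fin.cast (congrArg b h) y) else 0
  have h1 : (chainBD B D m n T).mulVec (fun x => v x.1 x.2) ⟨⟨j, hj⟩, y⟩ =
      ∑ i : Set.Icc m n, f i := Fintype.sum_sigma _
  have h2 : f = fun i => g i + g' i := by
    funext i
    have hne : i.castSucc ≠ i.succ := Fin.castSucc_lt_succ.ne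
    by_cases hc : j = i.castSucc
    · have hs : j ≠ i.succ := fun h => hne (hc.symm.trans h)
      simp only [f, g, g', dif_pos hc, dif_neg hs, add_zero]
      rfl
    · by_cases hs : j = i.succ
      · simp only [f, g, g', dif_neg hc, dif_pos hs, zero_add]
        rfl
      · simp [f, g, g', hc, hs]
  have hg : ∑ i, g i = leftEnd (b := fun j => Fin (b j) → ℍ[ℝ]) (fun i => colLin (B i)) v j y := by
    clear_value f
    clear h1 h2
    cases j using Fin.lastCases with
    | last =>
      rw [leftEnd_last]
      exact Finset.sum_eq_zero fun i _ => dif_neg (Fin.castSucc_lt_last i).ne'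
    | cast i =>
      rw [leftEnd_castSucc, Finset.sum_eq_single i]
      · simp [g]
      · exact fun i' _ h => dif_neg fun h' => h (Fin.castSucc_inj.1 h').symm
      · simp
  have hg' : ∑ i, g' i = rightEnd (b := fun j => Fin (b j) → ℍ[ℝ]) (fun i => colLin (D i)) v j y := by
    clear_value f g
    clear h1 h2 hg
    cases j using Fin.cases with
    | zero =>
      rw [rightEnd_zero]
      exact Finset.sum_eq_zero fun i _ => dif_neg (Fin.succ_ne_zero i).symm
    | succ i =>
      rw [rightEnd_succ, Finset.sum_eq_single i]
      · simp [g']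
      · exact fun i' _ h => dif_neg fun h' => h (Fin.succ_inj.1 h').symm
      · simp
  rw [h1, sum_subtype_eq_sum _ f fun i hi => by simp [f, hv i hi], h2, Finset.sum_add_distrib,
    hg, hg']
  rfl

theorem blockDiagonal'_mulVec (m n : Fin k) (v : ∀ i, Fin (q i) → ℍ[ℝ])
    (x : Σ i : Set.Icc m n, Fin (p i)) :
    (Matrix.blockDiagonal' fun i : Set.Icc m n =>
      (-1 : ℍ[ℝ]) ^ ((i : Fin k).val - m.val) • E i).mulVec (fun x => v x.1 x.2) x =
      ((-1 : ℤ) ^ ((x.1 : Fin k).val - m.val) • (E x.1).mulVec (v x.1)) x.2 := by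
  obtain ⟨i, x⟩ := x
  have h1 : (Matrix.blockDiagonal' fun i : Set.Icc m n =>
      (-1 : ℍ[ℝ]) ^ ((i : Fin k).val - m.val) • E i).mulVec (fun x => v x.1 x.2) ⟨i, x⟩ =
      (((-1 : ℍ[ℝ]) ^ ((i : Fin k).val - m.val) • E i).mulVec (v i)) x := by
    rw [Matrix.mulVec, dotProduct, Fintype.sum_sigma, Finset.sum_eq_single i]
    · simp [Matrix.mulVec, dotProduct, Matrix.blockDiagonal'_apply]
    · intro i' _ h
      simp [Matrix.blockDiagonal'_apply, h.symm]
    · simp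
  rw [h1]
  rcases Nat.even_or_odd ((i : Fin k).val - m.val) with h | h
  · simp [h.neg_one_pow]
  · simp [h.neg_one_pow, Matrix.neg_mulVec]

/-- The rank equality of a staircase matrix is a chain condition. -/
theorem rankEq_iff_chainCond {m n : Fin k} (e e' : Prop) (S T : Set (Fin (k + 1)))
    (hS : ∀ j, j ∈ S ↔ (m.castSucc ≤ j ∧ j ≤ n.succ) ∧ (j = m.castSucc → ¬ e) ∧
      (j = n.succ → ¬ e'))
    (hT : ∀ j, j ∈ T ↔ (m.castSucc ≤ j ∧ j ≤ n.succ) ∧ (j = m.castSucc → e) ∧ (j = n.succ → e')) :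
    RankEq A B C D E m n S T ↔
      ChainCond (a := fun j => Fin (a j) → ℍ[ℝ]) (b := fun j => Fin (b j) → ℍ[ℝ])
        (fun i => colLin (A i)) (fun i => colLin (B i)) (fun i => colLin (C i))
        (fun i => colLin (D i)) (fun i => colLin (E i)) m n e e' := by
  classical
  -- The staircase counts signs from `m`, the chain condition from `0`; the discrepancy is the
  -- global factor `(-1) ^ m`, its own inverse.
  have hsign (i : Fin k) (hi : m ≤ i) :
      (-1 : ℤ) ^ (i : ℕ) = (-1 : ℤ) ^ (m : ℕ) * (-1 : ℤ) ^ ((i : ℕ) - (m : ℕ)) := by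
    rw [← pow_add, Nat.add_sub_cancel' hi]
  have hsq : (-1 : ℤ) ^ (m : ℕ) * (-1 : ℤ) ^ (m : ℕ) = 1 := by
    rw [← mul_pow]; simp
  unfold RankEq staircase
  rw [rank_fromBlocks_zero_eq_iff]
  constructor
  · intro h v hv hends
    obtain ⟨u, hu⟩ := h (fun x => v x.1 x.2) (by
      ext1 y
      rw [chainBD_mulVec B D m n T v hv, hends]
      · rfl
      · exact ((hT _).1 y.1.2).2.1
      · exact ((hT _).1 y.1.2).2.2)
    -- A constrained end is absent from `S`, so extension by zero supplies the required vanishing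
    -- there.
    let u' (j : Fin (k + 1)) : Fin (a j) → ℍ[ℝ] := fun y => if h : j ∈ S then u ⟨⟨j, h⟩, y⟩ else 0
    have hu' (j) (hj : j ∉ S) : u' j = 0 := by
      ext1 y
      exact dif_neg hj
    have huu : u = fun y => u' y.1 y.2 := by
      funext ⟨⟨j, hj⟩, y⟩
      simp only [u', dif_pos hj]
    refine ⟨fun j => (-1 : ℤ) ^ (m : ℕ) • u' j, fun he => ?_, fun he => ?_, fun i hmi hin => ?_⟩
    · beta_reduce
      rw [hu' _ fun hj => ((hS _).1 hj).2.1 rfl he, smul_zero]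
    · beta_reduce
      rw [hu' _ fun hj => ((hS _).1 hj).2.2 rfl he, smul_zero]
    · rw [map_zsmul, map_zsmul, ← smul_add, hsign i hmi, mul_smul]
      congr 1
      ext1 x
      have hx := congrFun hu ⟨⟨i, hmi, hin⟩, x⟩
      rw [blockDiagonal'_mulVec, huu, chainAC_mulVec A C m n S u' hu'] at hx
      exact hx
  · intro h v hv
    let v' (i : Fin k) : Fin (q i) → ℍ[ℝ] :=
      fun x => if h : i ∈ Set.Icc m n then v ⟨⟨i, h⟩, x⟩ else 0
    have hv' (i) (hi : ¬ (m ≤ i ∧ i ≤ n)) : v' i = 0 := by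
      ext1 y
      exact dif_neg hi
    have hvv : v = fun y => v' y.1 y.2 := by
      funext ⟨⟨j, hj⟩, y⟩
      simp only [v', dif_pos hj]
    rw [hvv] at hv ⊢
    obtain ⟨u, hum, hun, hu⟩ := h v' hv' (by
      intro l hl hl'
      by_cases hlT : l ∈ T
      · ext1 y
        rw [← chainBD_mulVec B D m n T v' hv' ⟨⟨l, hlT⟩, y⟩, hv]
        rfl
      · have hl2 : ¬ (m.castSucc ≤ l ∧ l ≤ n.succ) := fun h => hlT ((hT l).2 ⟨h, hl, hl'⟩)
        rw [ends_apply, leftEnd_eq_zero, rightEnd_eq_zero, add_zero]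
        · rintro i rfl
          exact hv' i fun h => hl2 ⟨(Fin.castSucc_lt_succ_iff.2 h.1).le, Fin.succ_le_succ_iff.2 h.2⟩
        · rintro i rfl
          exact hv' i fun h => hl2 ⟨h.1, (Fin.castSucc_lt_succ_iff.2 h.2).le⟩)
    let u' (j : Fin (k + 1)) : Fin (a j) → ℍ[ℝ] := if j ∈ S then (-1 : ℤ) ^ (m : ℕ) • u j else 0
    have hu' (j) (hj : j ∉ S) : u' j = 0 := if_neg hj
    have huu (j) (h1 : m.castSucc ≤ j) (h2 : j ≤ n.succ) : u' j = (-1 : ℤ) ^ (m : ℕ) • u j := by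
      by_cases hj : j ∈ S
      · exact if_pos hj
      · rw [hu' j hj]
        rw [hS] at hj
        by_cases he : j = m.castSucc ∧ e
        · obtain ⟨rfl, he⟩ := he
          rw [hum he, smul_zero]
        · by_cases he' : j = n.succ ∧ e'
          · obtain ⟨rfl, he'⟩ := he'
            rw [hun he', smul_zero]
          · exact absurd ⟨⟨h1, h2⟩, not_and.1 he, not_and.1 he'⟩ hj
    refine ⟨fun y => u' y.1 y.2, ?_⟩
    funext ⟨⟨i, hmi, hin⟩, x⟩
    rw [blockDiagonal'_mulVec, chainAC_mulVec A C m n S u' hu']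
    have h1 := hu i hmi hin
    simp only [colLin_apply] at h1
    have h2 : (-1 : ℤ) ^ ((i : ℕ) - (m : ℕ)) • (E i).mulVec (v' i) =
        (-1 : ℤ) ^ (m : ℕ) • ((A i).mulVec (u i.castSucc) + (C i).mulVec (u i.succ)) := by
      rw [← h1, hsign i hmi, smul_smul, ← mul_assoc, hsq, one_mul]
    have h3 := huu i.castSucc hmi (Fin.castSucc_lt_succ_iff.2 hin).le
    have h4 := huu i.succ (Fin.castSucc_lt_succ_iff.2 hmi).le (Fin.succ_le_succ_iff.2 hin)
    refine congrFun (h2.trans ?_) x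
    simp only [h3, h4, ← colLin_apply, map_zsmul, smul_add]

theorem exists_isSolution_iff_chainCond :
    (∃ X : ∀ j : Fin (k + 1), Matrix (Fin (a j)) (Fin (b j)) ℍ[ℝ], IsSolution A B C D E X) ↔
      ∀ m n, m ≤ n → ∀ e e', ChainCond (a := fun j => Fin (a j) → ℍ[ℝ])
        (b := fun j => Fin (b j) → ℍ[ℝ]) (fun i => colLin (A i)) (fun i => colLin (B i))
        (fun i => colLin (C i)) (fun i => colLin (D i)) (fun i => colLin (E i)) m n e e' := by
  rw [← exists_solution_iff_chainCond]
  constructor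
  · rintro ⟨X, hX⟩
    refine ⟨fun j => colLin (X j), fun i => ?_⟩
    rw [← hX i, colLin_add, colLin_mul, colLin_mul, colLin_mul, colLin_mul]
    rfl
  · rintro ⟨X, hX⟩
    choose Y hY using fun j => colLin_surjective (X j)
    refine ⟨Y, fun i => colLin_injective ?_⟩
    rw [← hX i, colLin_add, colLin_mul, colLin_mul, colLin_mul, colLin_mul, hY, hY]
    rfl

end Matrices

end Sylvester

/-! ### The main theorem -/

theorem theorem2p1 {k : ℕ} {p q : Fin k → ℕ} {a b : Fin (k + 1) → ℕ}
    (A : ∀ i : Fin k, Matrix (Fin (p i)) (Fin (a i.castSucc)) ℍ[ℝ])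
    (B : ∀ i : Fin k, Matrix (Fin (b i.castSucc)) (Fin (q i)) ℍ[ℝ])
    (C : ∀ i : Fin k, Matrix (Fin (p i)) (Fin (a i.succ)) ℍ[ℝ])
    (D : ∀ i : Fin k, Matrix (Fin (b i.succ)) (Fin (q i)) ℍ[ℝ])
    (E : ∀ i : Fin k, Matrix (Fin (p i)) (Fin (q i)) ℍ[ℝ]) :
    (∃ X : ∀ j : Fin (k + 1), Matrix (Fin (a j)) (Fin (b j)) ℍ[ℝ],
        Sylvester.IsSolution A B C D E X) ↔
      (∀ i : Fin k,
        Sylvester.rank (Matrix.fromCols (Matrix.fromCols (A i) (E i)) (C i)) =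
            Sylvester.rank (Matrix.fromCols (A i) (C i)) ∧
        Sylvester.rank (Matrix.fromRows (Matrix.fromRows (B i) (E i)) (D i)) =
            Sylvester.rank (Matrix.fromRows (B i) (D i)) ∧
        Sylvester.rank (Matrix.fromBlocks (A i) (E i) 0 (D i)) =
            Sylvester.rank (A i) + Sylvester.rank (D i) ∧
        Sylvester.rank (Matrix.fromBlocks (B i) 0 (E i) (C i)) =
            Sylvester.rank (B i) + Sylvester.rank (C i)) ∧
      (∀ m n : Fin k, m < n →
        Sylvester.RankEq A B C D E m n
          (Set.Icc m.castSucc n.succ) (Set.Ioo m.castSucc n.succ) ∧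
        Sylvester.RankEq A B C D E m n
          (Set.Ioo m.castSucc n.succ) (Set.Icc m.castSucc n.succ) ∧
        Sylvester.RankEq A B C D E m n
          (Set.Ico m.castSucc n.succ) (Set.Ioc m.castSucc n.succ) ∧
        Sylvester.RankEq A B C D E m n
          (Set.Ioc m.castSucc n.succ) (Set.Ico m.castSucc n.succ)) := by
  rw [Sylvester.exists_isSolution_iff_chainCond]
  have hle : ∀ P : Fin k → Fin k → Prop,
      (∀ m n, m ≤ n → P m n) ↔ (∀ i, P i i) ∧ ∀ m n, m < n → P m n := fun P =>
    ⟨fun h => ⟨fun i => h i i le_rfl, fun m n hmn => h m n hmn.le⟩, fun h m n hmn =>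
      hmn.lt_or_eq.elim (h.2 m n) fun hmn => hmn ▸ h.1 m⟩
  rw [hle]
  refine and_congr (forall_congr' fun i => ?_) (forall₃_congr fun m n hmn => ?_)
  · rw [Sylvester.rank_fromCols_eq_iff, Sylvester.rank_fromRows_eq_iff,
      Sylvester.rank_fromBlocks_upper_eq_iff, Sylvester.rank_fromBlocks_lower_eq_iff]
    simp only [Prop.forall, Sylvester.chainCond_self_iff, Sylvester.colLin_apply]
    simp only [true_imp_iff, false_imp_iff, true_and, exists_and_left, exists_eq_left,
      Matrix.mulVec_zero, add_zero, zero_add]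
    tauto
  -- An end constrained by `True` belongs to the rows `T` and not to the columns `S`; a free end
  -- does the opposite. This matches the four pairs of intervals.
  · rw [Sylvester.rankEq_iff_chainCond A B C D E False False (Set.Icc _ _),
      Sylvester.rankEq_iff_chainCond A B C D E True True (Set.Ioo _ _),
      Sylvester.rankEq_iff_chainCond A B C D E False True (Set.Ico _ _),
      Sylvester.rankEq_iff_chainCond A B C D E True False (Set.Ioc _ _)]
    · simp only [Prop.forall]
      tauto
    all_goals
      intro j
      simp only [Set.mem_Icc, Set.mem_Ioo, Set.mem_Ico, Set.mem_Ioc]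
      grind
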